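/- Composition of relations is $(R'\circ R) = \{(x,z) : \exists y,\ x\mathrel{R}y\mathrel{R'}z\}$, and $R[F]$ is the image of a set $F$ under $R$. \emph{Allegories.} An allegory is a category whose hom-sets are partially ordered so that composition is monotone and binary meets exist, together with an involutive identity-on-objects contravariant endofunctor $(-)^\dagger$ that preserves the order, such that $gf\wedge h\le (g\wedge hf^\dagger)f$ for all $f\colon C\to D$, $g\colon D\to E$, $h\colon C\to E$. An equivalence of allegories is a functor that preserves binary meets of morphisms, commutes with $(-)^\dagger$, and is an equivalence of categories. \emph{Spaces.} Objects of $\mathsf{StoneE}^{\mathsf R}$ are pairs $(X,E)$ of a Stone space $X$ and a closed equivalence relation $E$ on $X$; morphisms $(X,E)\to(X',E')$ are closed relations $R\subseteq X\times X'$ with $R\circ E=R=E'\circ R$. Composition is composition of relations, the identity on $(X,E)$ is $E$, the order is inclusion, and $R^\dagger$ is the converse of $R$. $\mathsf{Gle}^{\mathsf R}$ is the full subcategory of Gleason spaces, i.e. of those $(X,E)$ such that $X$ is extremally disconnected and $E$ is irreducible: if $F$ is a proper closed subset of $X$, then so is $E[F]$. \emph{Algebras.} A subordination $S\colon A\to B$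 between boolean algebras is a relation such that $0\mathrel{S}0$; $1\mathrel{S}1$; $a,b\mathrel{S}c$ implies $(a\vee b)\mathrel{S}c$; $a\mathrel{S}c,d$ implies $a\mathrel{S}(c\wedge d)$; and $a\le b\mathrel{S}c\le d$ implies $a\mathrel{S}d$. An $\mathsf{S5}$-subordination on $B$ is a subordination $S\colon B\to B$ such that $a\mathrel{S}b$ implies $a\le b$, implies $\neg b\mathrel{S}\neg a$, and implies that $a\mathrel{S}c\mathrel{S}b$ for some $c\in B$. Objects of $\mathsf{SubS5}^{\mathsf S}$ are pairs $(B,S)$ of a boolean algebra $B$ and an $\mathsf{S5}$-subordination $S$ on $B$; morphisms $(B,S)\to(B',S')$ are subordinations $T\colon B\to B'$ with $T\circ S=T=S'\circ T$. Composition is composition of relations, the identity on $(B,S)$ is $S$, the order is reverse inclusion, and $b\mathrel{T^\dagger}a$ iff $\neg a\mathrel{T}\neg b$. $\mathsf{DeV}^{\mathsf S}$ is the full subcategory of de Vries algebras, i.e. of those $(B,S)$ such that $B$ is complete and (S8) if $a\ne0$, then there is $b\neq 0$ with $b\mathrel{S}a$. \emph{Functors.} $\mathsf{Clop}\colon\mathsf{StoneE}^{\mathsf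 R}\to\mathsf{SubS5}^{\mathsf S}$ sends $(X,E)$ to $(\mathsf{Clop}(X),S_E)$ and $R$ to $S_R$, where $\mathsf{Clop}(X)$ is the boolean algebra of clopen subsets of $X$ and $U\mathrel{S_R}V$ iff $R[U]\subseteq V$. $\mathsf{Ult}\colon\mathsf{SubS5}^{\mathsf S}\to\mathsf{StoneE}^{\mathsf R}$ sends $(B,S)$ to $(\mathsf{Ult}(B),R_S)$ and $T$ to $R_T$, where $\mathsf{Ult}(B)$ is the Stone space of ultrafilters of $B$ and $x\mathrel{R_S}y$ iff $S[x]\subseteq y$. \textbf{Theorem.} $\mathsf{StoneE}^{\mathsf R}$, $\mathsf{SubS5}^{\mathsf S}$, $\mathsf{Gle}^{\mathsf R}$ and $\mathsf{DeV}^{\mathsf S}$ are allegories, $\mathsf{Clop}$ and $\mathsf{Ult}$ are mutually quasi-inverse equivalences of allegories between $\mathsf{StoneE}^{\mathsf R}$ and $\mathsf{SubS5}^{\mathsf S}$, and this equivalence restricts to an equivalence of allegories between $\mathsf{Gle}^{\mathsf R}$ and $\mathsf{DeV}^{\mathsf S}$. That is, $\mathsf{Clop}$ maps Gleason spaces to de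 Vries algebras, $\mathsf{Ult}$ maps de Vries algebras to Gleason spaces, and the restricted functors are equivalences of allegories, quasi-inverse to each other through restrictions of natural isomorphisms $\mathrm{id}\cong\mathsf{Ult}\circ\mathsf{Clop}$ and $\mathsf{Clop}\circ\mathsf{Ult}\cong\mathrm{id}$ on the larger categories. Moreover, a boolean algebra $B$ is complete iff $\mathsf{Ult}(B)$ is extremally disconnected, and for an $\mathsf{S5}$-subordination $S$ on a boolean algebra, $R_S$ is irreducible iff $S$ satisfies (S8). -/

import Mathlib

open CategoryTheory
open scoped SetRel

universe w v v' u' u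

namespace ClosedRel

/-! ### Allegories -/

section Allegories

/-- An order-enriched category: every hom-set is partially ordered and composition is monotone. -/
class OrderEnriched (C : Type u') [Category.{v} C] where
  homOrder : ∀ X Y : C, PartialOrder (X ⟶ Y)
  comp_mono : ∀ {X Y Z : C} {f f' : X ⟶ Y} {g g' : Y ⟶ Z}, f ≤ f' → g ≤ g' → f ≫ g ≤ f' ≫ g'

attribute [reducible, instance] OrderEnriched.homOrder

/-- A dagger category: an identity-on-objects, involutive, contravariant endofunctor. -/
class DaggerCategory (C : Type u') [Category.{v} C] where
  dagger : ∀ {X Y : C}, (X ⟶ Y) → (Y ⟶ X)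
  dagger_id : ∀ X : C, dagger (𝟙 X) = 𝟙 X
  dagger_comp : ∀ {X Y Z : C} (f : X ⟶ Y) (g : Y ⟶ Z), dagger (f ≫ g) = dagger g ≫ dagger f
  dagger_dagger : ∀ {X Y : C} (f : X ⟶ Y), dagger (dagger f) = f

open DaggerCategory

/-- An order-enriched dagger category is an allegory if its hom-sets have binary meets, the dagger
is monotone, and the modular law `g f ∧ h ≤ (g ∧ h f†) f` holds. (Mathlib composes from left to
right, so the composite `g f` is written `f ≫ g`.) -/
structure IsAllegory (C : Type u') [Category.{v} C] [OrderEnriched C] [DaggerCategory C] :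
    Prop where
  exists_meet : ∀ {X Y : C} (f g : X ⟶ Y), ∃ m : X ⟶ Y, IsGLB {f, g} m
  dagger_mono : ∀ {X Y : C} {f g : X ⟶ Y}, f ≤ g → dagger f ≤ dagger g
  modular : ∀ {X Y Z : C} (f : X ⟶ Y) (g : Y ⟶ Z) (h m : X ⟶ Z) (n : Y ⟶ Z),
    IsGLB {f ≫ g, h} m → IsGLB {g, dagger f ≫ h} n → m ≤ f ≫ n

variable {C : Type u'} [Category.{v} C] [OrderEnriched C] [DaggerCategory C]
  {D : Type w} [Category.{v'} D] [OrderEnriched D] [DaggerCategory D]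

/-- A functor is a morphism of allegories if it preserves binary meets of morphisms and commutes
with the dagger. -/
structure IsAllegoryMorphism (F : C ⥤ D) : Prop where
  map_meet : ∀ {X Y : C} (f g m : X ⟶ Y), IsGLB {f, g} m → IsGLB {F.map f, F.map g} (F.map m)
  map_dagger : ∀ {X Y : C} (f : X ⟶ Y), F.map (dagger f) = dagger (F.map f)

/-- An equivalence of allegories is a morphism of allegories that is an equivalence of
categories. -/
def IsAllegoryEquivalence (F : C ⥤ D) : Prop :=
  IsAllegoryMorphism F ∧ F.IsEquivalence

/-- A full subcategory inherits the order on hom-sets. -/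
instance (P : ObjectProperty C) : OrderEnriched P.FullSubcategory where
  homOrder X Y := PartialOrder.lift (fun f : X ⟶ Y => f.hom) (fun _ _ h => P.hom_ext h)
  comp_mono h h' := OrderEnriched.comp_mono (C := C) h h'

/-- A full subcategory inherits the dagger. -/
instance (P : ObjectProperty C) : DaggerCategory P.FullSubcategory where
  dagger f := ObjectProperty.homMk (dagger f.hom)
  dagger_id X := P.hom_ext (dagger_id X.obj)
  dagger_comp f g := P.hom_ext (dagger_comp f.hom g.hom)
  dagger_dagger f := P.hom_ext (dagger_dagger f.hom)

end Allegories

/-! ### Closed relations and the allegory of S5-subordination spaces -/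

section Spaces

theorem isClosed_comp {X Y Z : Type*} [TopologicalSpace X] [TopologicalSpace Y]
    [TopologicalSpace Z] [CompactSpace Y] {R : SetRel X Y} {Q : SetRel Y Z}
    (hR : IsClosed R) (hQ : IsClosed Q) : IsClosed (R ○ Q) := by
  have h : IsClosed {p : (X × Z) × Y | (p.1.1, p.2) ∈ R ∧ (p.2, p.1.2) ∈ Q} :=
    (hR.preimage (by fun_prop : Continuous fun p : (X × Z) × Y => (p.1.1, p.2))).inter
      (hQ.preimage (by fun_prop : Continuous fun p : (X × Z) × Y => (p.2, p.1.2)))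
  convert isClosedMap_fst_of_compactSpace _ h using 1
  ext ⟨x, z⟩
  simp

theorem isClosed_inv {X Y : Type*} [TopologicalSpace X] [TopologicalSpace Y] {R : SetRel X Y}
    (hR : IsClosed R) : IsClosed R.inv :=
  hR.preimage continuous_swap

theorem isClosed_image {X Y : Type*} [TopologicalSpace X] [TopologicalSpace Y]
    [CompactSpace X] {R : SetRel X Y} (hR : IsClosed R) {F : Set X} (hF : IsClosed F) :
    IsClosed (R.image F) := by
  have h : IsClosed (R ∩ Prod.fst ⁻¹' F) := hR.inter (hF.preimage continuous_fst)
  convert isClosedMap_snd_of_compactSpace _ h using 1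
  ext y
  simp [and_comm]

/-- `R` is an equivalence relation. -/
def IsEquivRel {X : Type*} (R : SetRel X X) : Prop :=
  Equivalence fun x y => (x, y) ∈ R

theorem IsEquivRel.comp_self {X : Type*} {R : SetRel X X} (h : IsEquivRel R) : R ○ R = R := by
  ext ⟨x, z⟩
  exact ⟨fun ⟨_, h1, h2⟩ => h.trans h1 h2, fun h1 => ⟨x, h.refl x, h1⟩⟩

theorem IsEquivRel.inv_eq {X : Type*} {R : SetRel X X} (h : IsEquivRel R) : R.inv = R := by
  ext ⟨x, z⟩
  exact ⟨fun h1 => h.symm h1, fun h1 => h.symm h1⟩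

/-- An S5-subordination space: a Stone space with a closed equivalence relation. These are the
objects of the category `StoneE^R`. -/
structure StoneER where
  space : Profinite.{u}
  rel : SetRel space space
  isClosed : IsClosed rel
  isEquivRel : IsEquivRel rel

/-- A compatible closed relation `R` from `(X, E)` to `(X', E')`: `R ∘ E = R = E' ∘ R`. -/
@[ext]
structure StoneER.Hom (X Y : StoneER.{u}) where
  rel : SetRel X.space Y.space
  isClosed : IsClosed rel
  rel_comp : X.rel ○ rel = rel
  comp_rel : rel ○ Y.rel = rel

/-- The category `StoneE^R`: composition is relation composition, and the identity on `(X, E)`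
is `E`. -/
instance : Category StoneER.{u} where
  Hom := StoneER.Hom
  id X := ⟨X.rel, X.isClosed, X.isEquivRel.comp_self, X.isEquivRel.comp_self⟩
  comp f g := ⟨f.rel ○ g.rel, isClosed_comp f.isClosed g.isClosed,
    by rw [← SetRel.comp_assoc, f.rel_comp], by rw [SetRel.comp_assoc, g.comp_rel]⟩
  id_comp f := StoneER.Hom.ext f.rel_comp
  comp_id f := StoneER.Hom.ext f.comp_rel
  assoc f g h := StoneER.Hom.ext (SetRel.comp_assoc _ _ _)

/-- Hom-sets of `StoneE^R` are ordered by inclusion. -/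
instance : OrderEnriched StoneER.{u} where
  homOrder X Y :=
    { le := fun f g => f.rel ⊆ g.rel
      le_refl := fun _ => subset_rfl
      le_trans := fun _ _ _ => subset_trans
      le_antisymm := fun _ _ h h' => StoneER.Hom.ext (subset_antisymm h h') }
  comp_mono h h' := SetRel.comp_subset_comp h h'

/-- The dagger of `StoneE^R` is the converse relation. -/
instance : DaggerCategory StoneER.{u} where
  dagger {X Y} f := ⟨f.rel.inv, isClosed_inv f.isClosed,
    by rw [← Y.isEquivRel.inv_eq, ← SetRel.inv_comp, f.comp_rel],
    by rw [← X.isEquivRel.inv_eq, ← SetRel.inv_comp, f.rel_comp]⟩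
  dagger_id X := StoneER.Hom.ext X.isEquivRel.inv_eq
  dagger_comp f g := StoneER.Hom.ext (SetRel.inv_comp _ _)
  dagger_dagger _ := rfl

/-- A relation `E` on a space is irreducible if the `E`-image of each proper closed subset is a
proper closed subset. -/
def IsIrreducibleRel {X : Type*} [TopologicalSpace X] (E : SetRel X X) : Prop :=
  ∀ F : Set X, IsClosed F → F ≠ Set.univ → IsClosed (E.image F) ∧ E.image F ≠ Set.univ

/-- A Gleason space: an S5-subordination space `(X, E)` with `X` extremally disconnected and `E`
irreducible. -/
def gleason : ObjectProperty StoneER.{u} :=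
  fun X => ExtremallyDisconnected X.space ∧ IsIrreducibleRel X.rel

/-- The full subcategory `Gle^R` of `StoneE^R` on the Gleason spaces. -/
abbrev GleR : Type (u + 1) := gleason.{u}.FullSubcategory

end Spaces

/-! ### Subordinations and the allegory of S5-subordination algebras -/

section Algebras

/-- Subordination relations between boolean algebras. -/
structure IsSubordination {A B : Type*} [BooleanAlgebra A] [BooleanAlgebra B] (S : SetRel A B) :
    Prop where
  bot_bot : ⊥ ~[S] ⊥
  top_top : ⊤ ~[S] ⊤
  sup_left : ∀ {a b : A} {c : B}, a ~[S] c → b ~[S] c → (a ⊔ b) ~[S] c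
  inf_right : ∀ {a : A} {c d : B}, a ~[S] c → a ~[S] d → a ~[S] (c ⊓ d)
  mono : ∀ {a b : A} {c d : B}, a ≤ b → b ~[S] c → c ≤ d → a ~[S] d

/-- S5-subordinations on a boolean algebra. -/
structure IsS5Subordination {B : Type*} [BooleanAlgebra B] (S : SetRel B B) : Prop extends
    IsSubordination S where
  le : ∀ {a b : B}, a ~[S] b → a ≤ b
  compl : ∀ {a b : B}, a ~[S] b → bᶜ ~[S] aᶜ
  interp : ∀ {a b : B}, a ~[S] b → ∃ c, a ~[S] c ∧ c ~[S] b

/-- The relation `Ŝ` with `b Ŝ a` iff `¬a S ¬b`. -/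
def complInv {A B : Type*} [BooleanAlgebra A] [BooleanAlgebra B] (S : SetRel A B) : SetRel B A :=
  {p | p.2ᶜ ~[S] p.1ᶜ}

theorem IsSubordination.comp {A B C : Type*} [BooleanAlgebra A] [BooleanAlgebra B]
    [BooleanAlgebra C] {S : SetRel A B} {T : SetRel B C} (hS : IsSubordination S)
    (hT : IsSubordination T) : IsSubordination (S ○ T) where
  bot_bot := ⟨⊥, hS.bot_bot, hT.bot_bot⟩
  top_top := ⟨⊤, hS.top_top, hT.top_top⟩
  sup_left := fun ⟨x, h1, h2⟩ ⟨y, h3, h4⟩ =>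
    ⟨x ⊔ y, hS.sup_left (hS.mono le_rfl h1 le_sup_left) (hS.mono le_rfl h3 le_sup_right),
      hT.sup_left h2 h4⟩
  inf_right := fun ⟨x, h1, h2⟩ ⟨y, h3, h4⟩ =>
    ⟨x ⊓ y, hS.inf_right h1 h3,
      hT.inf_right (hT.mono inf_le_left h2 le_rfl) (hT.mono inf_le_right h4 le_rfl)⟩
  mono := fun h ⟨x, h1, h2⟩ h' => ⟨x, hS.mono h h1 le_rfl, hT.mono le_rfl h2 h'⟩

theorem IsSubordination.complInv {A B : Type*} [BooleanAlgebra A] [BooleanAlgebra B]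
    {S : SetRel A B} (hS : IsSubordination S) : IsSubordination (complInv S) where
  bot_bot := by simpa [ClosedRel.complInv] using hS.top_top
  top_top := by simpa [ClosedRel.complInv] using hS.bot_bot
  sup_left h h' := by
    simpa [ClosedRel.complInv] using hS.inf_right h h'
  inf_right h h' := by
    simpa [ClosedRel.complInv] using hS.sup_left h h'
  mono h h' h'' := hS.mono (compl_le_compl h'') h' (compl_le_compl h)

theorem complInv_complInv {A B : Type*} [BooleanAlgebra A] [BooleanAlgebra B]
    (S : SetRel A B) : complInv (complInv S) = S := by
  ext ⟨a, b⟩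
  simp [complInv]

theorem complInv_comp {A B C : Type*} [BooleanAlgebra A] [BooleanAlgebra B] [BooleanAlgebra C]
    (S : SetRel A B) (T : SetRel B C) : complInv (S ○ T) = complInv T ○ complInv S := by
  ext ⟨c, a⟩
  constructor
  · rintro ⟨b, h1, h2⟩
    exact ⟨bᶜ, by simpa [complInv] using h2, by simpa [complInv] using h1⟩
  · rintro ⟨b, h1, h2⟩
    exact ⟨bᶜ, h2, h1⟩

theorem IsS5Subordination.comp_self {B : Type*} [BooleanAlgebra B] {S : SetRel B B}
    (h : IsS5Subordination S) : S ○ S = S := by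
  ext ⟨a, b⟩
  exact ⟨fun ⟨_, h1, h2⟩ => h.mono (h.le h1) h2 le_rfl, fun h1 => h.interp h1⟩

theorem IsS5Subordination.complInv_eq {B : Type*} [BooleanAlgebra B] {S : SetRel B B}
    (h : IsS5Subordination S) : ClosedRel.complInv S = S := by
  ext ⟨a, b⟩
  exact ⟨fun h1 => by simpa using h.compl h1, fun h1 => h.compl h1⟩

/-- An S5-subordination algebra: a boolean algebra with an S5-subordination. These are the
objects of the category `SubS5^S`. -/
structure SubS5S where
  alg : BoolAlg.{u}
  sub : SetRel alg alg
  isS5 : IsS5Subordination sub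

/-- A compatible subordination `T` from `(B, S)` to `(B', S')`: `T ∘ S = T = S' ∘ T`. -/
@[ext]
structure SubS5S.Hom (A B : SubS5S.{u}) where
  rel : SetRel A.alg B.alg
  isSub : IsSubordination rel
  sub_comp : A.sub ○ rel = rel
  comp_sub : rel ○ B.sub = rel

/-- The category `SubS5^S`: composition is relation composition, and the identity on `(B, S)`
is `S`. -/
instance : Category SubS5S.{u} where
  Hom := SubS5S.Hom
  id A := ⟨A.sub, A.isS5.toIsSubordination, A.isS5.comp_self, A.isS5.comp_self⟩
  comp f g := ⟨f.rel ○ g.rel, f.isSub.comp g.isSub,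
    by rw [← SetRel.comp_assoc, f.sub_comp], by rw [SetRel.comp_assoc, g.comp_sub]⟩
  id_comp f := SubS5S.Hom.ext f.sub_comp
  comp_id f := SubS5S.Hom.ext f.comp_sub
  assoc f g h := SubS5S.Hom.ext (SetRel.comp_assoc _ _ _)

/-- Hom-sets of `SubS5^S` are ordered by reverse inclusion. -/
instance : OrderEnriched SubS5S.{u} where
  homOrder X Y :=
    { le := fun f g => g.rel ⊆ f.rel
      le_refl := fun _ => subset_rfl
      le_trans := fun _ _ _ h h' => subset_trans h' h
      le_antisymm := fun _ _ h h' => SubS5S.Hom.ext (subset_antisymm h' h) }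
  comp_mono h h' := SetRel.comp_subset_comp h h'

/-- The dagger of `SubS5^S` sends `T` to the relation `b T̂ a` iff `¬a T ¬b`. -/
instance : DaggerCategory SubS5S.{u} where
  dagger {A B} f := ⟨complInv f.rel, f.isSub.complInv,
    by rw [← B.isS5.complInv_eq, ← complInv_comp, f.comp_sub],
    by rw [← A.isS5.complInv_eq, ← complInv_comp, f.sub_comp]⟩
  dagger_id A := SubS5S.Hom.ext A.isS5.complInv_eq
  dagger_comp f g := SubS5S.Hom.ext (complInv_comp _ _)
  dagger_dagger f := SubS5S.Hom.ext (complInv_complInv _)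

/-- A boolean algebra is complete if every subset has a least upper bound. -/
def IsCompleteAlg (B : Type*) [BooleanAlgebra B] : Prop :=
  ∀ s : Set B, ∃ a, IsLUB s a

/-- For every `a ≠ 0` there is `b ≠ 0` with `b S a`. -/
def SatisfiesS8 {B : Type*} [BooleanAlgebra B] (S : SetRel B B) : Prop :=
  ∀ a : B, a ≠ ⊥ → ∃ b : B, b ≠ ⊥ ∧ b ~[S] a

/-- A de Vries algebra: an S5-subordination algebra `(B, S)` with `B` complete and `S`
satisfying S8. -/
def deVries : ObjectProperty SubS5S.{u} :=
  fun B => IsCompleteAlg B.alg ∧ SatisfiesS8 B.sub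

/-- The full subcategory `DeV^S` of `SubS5^S` on the de Vries algebras. -/
abbrev DeVS : Type (u + 1) := deVries.{u}.FullSubcategory

end Algebras

/-! ### The functor `Clop` -/

section Clop

open TopologicalSpace (Clopens)

/-- The relation `S_R` between clopen sets: `U S_R V` iff `R[U] ⊆ V`. -/
def clopRel {X Y : Type*} [TopologicalSpace X] [TopologicalSpace Y] (R : SetRel X Y) :
    SetRel (Clopens X) (Clopens Y) :=
  {p | R.image p.1 ⊆ p.2}

theorem clopRel_isSubordination {X Y : Type*} [TopologicalSpace X] [TopologicalSpace Y]
    (R : SetRel X Y) : IsSubordination (clopRel R) where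
  bot_bot := by rintro y ⟨x, hx, -⟩; exact hx
  top_top := fun _ _ => trivial
  sup_left := by
    rintro a b c h h' y ⟨x, hx | hx, hxy⟩
    exacts [h ⟨x, hx, hxy⟩, h' ⟨x, hx, hxy⟩]
  inf_right := fun h h' _ hy => ⟨h hy, h' hy⟩
  mono := by
    rintro a b c d hab h hcd y ⟨x, hx, hxy⟩
    exact hcd (h ⟨x, hab hx, hxy⟩)

theorem clopRel_comp {X Y Z : Type*} [TopologicalSpace X] [TopologicalSpace Y]
    [TopologicalSpace Z] [CompactSpace X] [CompactSpace Y] [CompactSpace Z] [T2Space Y]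
    [TotallyDisconnectedSpace Y] {R : SetRel X Y} {Q : SetRel Y Z} (hR : IsClosed R)
    (hQ : IsClosed Q) : clopRel (R ○ Q) = clopRel R ○ clopRel Q := by
  ext ⟨U, W⟩
  constructor
  · intro h
    have hc : IsClosed (R.image (U : Set X)) := isClosed_image hR U.isClosed
    have ho : IsOpen (Q.inv.image ((W : Set Z)ᶜ))ᶜ :=
      (isClosed_image (isClosed_inv hQ) W.isOpen.isClosed_compl).isOpen_compl
    obtain ⟨V, hV, h1, h2⟩ := exists_clopen_of_closed_subset_open hc ho (by
      rintro y ⟨x, hx, hxy⟩ ⟨z, hz, hyz⟩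
      exact hz (h ⟨x, hx, y, hxy, hyz⟩))
    refine ⟨⟨V, hV⟩, h1, ?_⟩
    rintro z ⟨y, hy, hyz⟩
    by_contra hz
    exact h2 hy ⟨z, hz, hyz⟩
  · rintro ⟨V, h1, h2⟩ z ⟨x, hx, y, hxy, hyz⟩
    exact h2 ⟨y, h1 ⟨x, hx, hxy⟩, hyz⟩

theorem clopRel_isS5 {X : Type*} [TopologicalSpace X] [CompactSpace X] [T2Space X]
    [TotallyDisconnectedSpace X] {E : SetRel X X} (hE : IsClosed E) (hE' : IsEquivRel E) :
    IsS5Subordination (clopRel E) where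
  toIsSubordination := clopRel_isSubordination E
  le := fun h x hx => h ⟨x, hx, hE'.refl x⟩
  compl := by
    rintro U V h y ⟨x, hx, hxy⟩ hy
    exact hx (h ⟨y, hy, hE'.symm hxy⟩)
  interp := by
    intro U V h
    rw [← hE'.comp_self, clopRel_comp hE hE] at h
    exact h

/-- The functor `Clop : StoneE^R ⥤ SubS5^S`, sending `(X, E)` to `(Clop X, S_E)` and `R` to
`S_R`. -/
def clop : StoneER.{u} ⥤ SubS5S.{u} where
  obj X := ⟨BoolAlg.of (Clopens X.space), clopRel X.rel, clopRel_isS5 X.isClosed X.isEquivRel⟩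
  map {X Y} f := ⟨clopRel f.rel, clopRel_isSubordination f.rel,
    (clopRel_comp X.isClosed f.isClosed).symm.trans (congrArg clopRel f.rel_comp),
    (clopRel_comp f.isClosed Y.isClosed).symm.trans (congrArg clopRel f.comp_rel)⟩
  map_id _ := rfl
  map_comp f g := SubS5S.Hom.ext (clopRel_comp f.isClosed g.isClosed)

end Clop

/-! ### The functor `Ult` -/

section Ult

/-- Ultrafilters of a boolean algebra. -/
@[ext]
structure Ult (B : Type*) [BooleanAlgebra B] where
  carrier : Set B
  top_mem : ⊤ ∈ carrier
  bot_notMem : ⊥ ∉ carrier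
  inf_mem : ∀ {a b : B}, a ∈ carrier → b ∈ carrier → a ⊓ b ∈ carrier
  mem_of_le : ∀ {a b : B}, a ≤ b → a ∈ carrier → b ∈ carrier
  mem_or_compl_mem : ∀ a : B, a ∈ carrier ∨ aᶜ ∈ carrier

variable {A B C : Type*} [BooleanAlgebra A] [BooleanAlgebra B] [BooleanAlgebra C]

theorem Ult.compl_mem_iff (x : Ult B) {a : B} : aᶜ ∈ x.carrier ↔ a ∉ x.carrier :=
  ⟨fun h h' => x.bot_notMem (by simpa using x.inf_mem h h'),
    fun h => (x.mem_or_compl_mem a).resolve_left h⟩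

theorem Ult.sup_mem_iff (x : Ult B) {a b : B} :
    a ⊔ b ∈ x.carrier ↔ a ∈ x.carrier ∨ b ∈ x.carrier := by
  refine ⟨fun h => ?_, fun h => h.elim (x.mem_of_le le_sup_left) (x.mem_of_le le_sup_right)⟩
  by_contra! h'
  refine x.compl_mem_iff.1 ?_ h
  rw [compl_sup]
  exact x.inf_mem (x.compl_mem_iff.2 h'.1) (x.compl_mem_iff.2 h'.2)

/-- The Stone topology, generated by the sets `{x | a ∈ x}`. -/
instance : TopologicalSpace (Ult B) :=
  TopologicalSpace.generateFrom {U | ∃ a : B, U = {x | a ∈ x.carrier}}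

theorem Ult.isOpen_basic (a : B) : IsOpen {x : Ult B | a ∈ x.carrier} :=
  TopologicalSpace.isOpen_generateFrom_of_mem ⟨a, rfl⟩

theorem Ult.isClopen_basic (a : B) : IsClopen {x : Ult B | a ∈ x.carrier} := by
  refine ⟨⟨?_⟩, isOpen_basic a⟩
  convert isOpen_basic aᶜ using 1
  ext x
  exact x.compl_mem_iff.symm

instance : TotallySeparatedSpace (Ult B) := by
  refine totallySeparatedSpace_iff_exists_isClopen.2 ?_
  intro x y hxy
  by_contra! h
  refine hxy (Ult.ext (Set.ext fun a => ⟨fun ha => ?_, fun ha => ?_⟩))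
  · by_contra hy
    exact h _ (Ult.isClopen_basic a) ha hy
  · by_contra hx
    exact h _ (Ult.isClopen_basic aᶜ) (x.compl_mem_iff.2 hx) (fun h' => y.compl_mem_iff.1 h' ha)

instance : CompactSpace (Ult B) := by
  refine ⟨isCompact_iff_ultrafilter_le_nhds.2 fun 𝒰 _ => ?_⟩
  have hc : ∀ a : B, {x : Ult B | aᶜ ∈ x.carrier} = {x : Ult B | a ∈ x.carrier}ᶜ :=
    fun a => Set.ext fun x => x.compl_mem_iff
  refine ⟨⟨{a | {x : Ult B | a ∈ x.carrier} ∈ 𝒰}, ?_, ?_, ?_, ?_, ?_⟩, trivial, ?_⟩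
  · exact Filter.mem_of_superset Filter.univ_mem fun x _ => x.top_mem
  · intro h
    obtain ⟨x, hx⟩ := 𝒰.nonempty_of_mem h
    exact x.bot_notMem hx
  · exact fun h h' => Filter.mem_of_superset (Filter.inter_mem h h') fun x hx =>
      x.inf_mem hx.1 hx.2
  · exact fun h h' => Filter.mem_of_superset h' fun x hx => x.mem_of_le h hx
  · intro a
    change _ ∈ 𝒰 ∨ {x : Ult B | aᶜ ∈ x.carrier} ∈ 𝒰
    rw [hc]
    exact 𝒰.mem_or_compl_mem _
  · rw [TopologicalSpace.nhds_generateFrom]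
    refine le_iInf₂ ?_
    rintro s ⟨hs, a, rfl⟩
    exact Filter.le_principal_iff.2 hs

/-- The relation `R_S` between ultrafilters: `x R_S y` iff `S[x] ⊆ y`. -/
def ultRel (S : SetRel A B) : SetRel (Ult A) (Ult B) :=
  {p | S.image p.1.carrier ⊆ p.2.carrier}

theorem ultRel_isClosed (S : SetRel A B) : IsClosed (ultRel S) := by
  have h : ultRel S = ⋂ p ∈ S, ((fun q : Ult A × Ult B => q.1) ⁻¹' {x | p.1 ∈ x.carrier})ᶜ ∪
      ((fun q : Ult A × Ult B => q.2) ⁻¹' {y | p.2 ∈ y.carrier}) := by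
    ext ⟨x, y⟩
    simp only [Set.mem_iInter]
    constructor
    · rintro h ⟨a, b⟩ hab
      exact or_iff_not_imp_left.2 fun ha => h ⟨a, not_not.1 ha, hab⟩
    · rintro h b ⟨a, ha, hab⟩
      exact (h (a, b) hab).resolve_left (not_not.2 ha)
  rw [h]
  exact isClosed_biInter fun p _ =>
    (((Ult.isClopen_basic p.1).preimage continuous_fst).compl.union
      ((Ult.isClopen_basic p.2).preimage continuous_snd)).isClosed

theorem ultRel_comp {S : SetRel A B} {T : SetRel B C} (hS : IsSubordination S)
    (hT : IsSubordination T) : ultRel (S ○ T) = ultRel S ○ ultRel T := by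
  ext ⟨x, z⟩
  constructor
  · intro h
    have hF : Order.IsPFilter (S.image x.carrier) := by
      refine .of_def ⟨⊤, ⊤, x.top_mem, hS.top_top⟩ ?_ ?_
      · rintro b ⟨a, ha, hab⟩ b' ⟨a', ha', hab'⟩
        exact ⟨b ⊓ b', ⟨a ⊓ a', x.inf_mem ha ha',
          hS.inf_right (hS.mono inf_le_left hab le_rfl) (hS.mono inf_le_right hab' le_rfl)⟩,
          inf_le_left, inf_le_right⟩
      · rintro b b' hb ⟨a, ha, hab⟩
        exact ⟨a, ha, hS.mono le_rfl hab hb⟩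
    have hI : Order.IsIdeal (T.preimage (z.carrierᶜ)) := by
      refine ⟨?_, ⟨⊥, ⊥, z.bot_notMem, hT.bot_bot⟩, ?_⟩
      · rintro b b' hb ⟨c, hc, hbc⟩
        exact ⟨c, hc, hT.mono hb hbc le_rfl⟩
      · rintro b ⟨c, hc, hbc⟩ b' ⟨c', hc', hbc'⟩
        exact ⟨b ⊔ b', ⟨c ⊔ c', fun h => (z.sup_mem_iff.1 h).elim hc hc',
          hT.sup_left (hT.mono le_rfl hbc le_sup_left) (hT.mono le_rfl hbc' le_sup_right)⟩,
          le_sup_left, le_sup_right⟩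
    have hd : Disjoint (hF.toPFilter : Set B) (hI.toIdeal : Set B) := by
      refine Set.disjoint_left.2 ?_
      rintro b ⟨a, ha, hab⟩ ⟨c, hc, hbc⟩
      exact hc (h ⟨a, ha, b, hab, hbc⟩)
    obtain ⟨J, hJ, hIJ, hFJ⟩ := DistribLattice.prime_ideal_of_disjoint_filter_ideal hd
    refine ⟨⟨(J : Set B)ᶜ, hJ.top_notMem, fun h => h J.bot_mem, ?_, ?_, ?_⟩, ?_, ?_⟩
    · exact fun ha hb hab => (hJ.mem_or_mem hab).elim ha hb
    · exact fun hab ha hb => ha (J.lower hab hb)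
    · intro a
      by_contra! h'
      have h1 : a ∈ J := not_not.1 h'.1
      have h2 : aᶜ ∈ J := not_not.1 h'.2
      exact hJ.top_notMem (by simpa using Order.Ideal.sup_mem h1 h2)
    · exact fun b hb hbJ => Set.disjoint_left.1 hFJ hb hbJ
    · rintro c ⟨b, hb, hbc⟩
      by_contra hc
      exact hb (hIJ ⟨c, hc, hbc⟩)
  · rintro ⟨y, h1, h2⟩ c ⟨a, ha, b, hab, hbc⟩
    exact h2 ⟨b, h1 ⟨a, ha, hab⟩, hbc⟩

theorem ultRel_isEquivRel {S : SetRel B B} (hS : IsS5Subordination S) :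
    IsEquivRel (ultRel S) where
  refl := fun x b ⟨_, ha, hab⟩ => x.mem_of_le (hS.le hab) ha
  symm := by
    rintro x y h b ⟨a, ha, hab⟩
    by_contra hb
    exact y.compl_mem_iff.1 (h ⟨bᶜ, x.compl_mem_iff.2 hb, hS.compl hab⟩) ha
  trans := by
    rintro x y z h h' b ⟨a, ha, hab⟩
    obtain ⟨c, hac, hcb⟩ := hS.interp hab
    exact h' ⟨c, h ⟨a, ha, hac⟩, hcb⟩

/-- The functor `Ult : SubS5^S ⥤ StoneE^R`, sending `(B, S)` to `(Ult B, R_S)` and `T` to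
`R_T`. -/
def ult : SubS5S.{u} ⥤ StoneER.{u} where
  obj B := ⟨Profinite.of (Ult B.alg), ultRel B.sub, ultRel_isClosed B.sub,
    ultRel_isEquivRel B.isS5⟩
  map {A B} f := ⟨ultRel f.rel, ultRel_isClosed f.rel,
    (ultRel_comp A.isS5.toIsSubordination f.isSub).symm.trans (congrArg ultRel f.sub_comp),
    (ultRel_comp f.isSub B.isS5.toIsSubordination).symm.trans (congrArg ultRel f.comp_sub)⟩
  map_id _ := rfl
  map_comp f g := StoneER.Hom.ext (ultRel_comp f.isSub g.isSub)

end Ult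

/-! ### Restricted functors -/

/-- The restriction of `Clop` to Gleason spaces, given that it sends them to de Vries algebras. -/
abbrev clopRestrict (h : ∀ X : StoneER.{u}, gleason X → deVries (clop.obj X)) :
    GleR.{u} ⥤ DeVS.{u} :=
  deVries.lift (gleason.ι ⋙ clop) fun X => h X.obj X.property

/-- The restriction of `Ult` to de Vries algebras, given that it sends them to Gleason spaces. -/
abbrev ultRestrict (h : ∀ B : SubS5S.{u}, deVries B → gleason (ult.obj B)) :
    DeVS.{u} ⥤ GleR.{u} :=
  gleason.lift (deVries.ι ⋙ ult) fun B => h B.obj B.property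

end ClosedRel

/-! Write φ(a) for the set of ultrafilters containing a. The heart of the matter is that
subordinations A → B and closed relations from `Ult A` to `Ult B` determine each other, with
inclusion reversed: a S b says exactly that the R_S-image of φ(a) lies in φ(b). That S can be read
off from R_S follows from two applications of the prime ideal theorem (`IsSubordination.rel_iff`);
that every closed relation arises this way holds because a pair outside a closed set has a basic box
around it that avoids the set (`exists_ultRel_eq`).

So `Ult` is full, embeds the ordered hom-sets, and commutes with the dagger. The allegory axioms are
checked by hand only for spaces, where they are facts about relations, and are pulled back along
`Ult`.

For the equivalence, compactness makes every ultrafilter of clopen sets the neighbourhood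
ultrafilter of a point. Composing this correspondence with the equivalence relation gives an
isomorphism (X, E) ≅ Ult(Clop(X, E)) with its dagger as inverse, natural in (X, E). Since `Ult` is
full and faithful, the other natural isomorphism is the preimage of the inverse of this one.

The restriction needs only the objects to match. Suprema in B correspond to closures of open sets in
`Ult B`. By symmetry of E = R_S, b S a says that φ(b) misses E[φ(¬a)], which turns (S8) into
irreducibility. -/

namespace ClosedRel

/-! ### Full order embeddings of order-enriched dagger categories -/

section Transport

open DaggerCategory

variable {C : Type u'} [Category.{v} C] [OrderEnriched C] [DaggerCategory C]
  {D : Type w} [Category.{v'} D] [OrderEnriched D] [DaggerCategory D]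

/-- A functor that embeds the ordered hom-sets and commutes with the dagger. -/
structure IsDaggerOrderEmbedding (F : C ⥤ D) : Prop where
  map_le_map_iff : ∀ {X Y : C} (f g : X ⟶ Y), F.map f ≤ F.map g ↔ f ≤ g
  map_dagger : ∀ {X Y : C} (f : X ⟶ Y), F.map (dagger f) = dagger (F.map f)

namespace IsDaggerOrderEmbedding

variable {F : C ⥤ D}

theorem faithful (hF : IsDaggerOrderEmbedding F) : F.Faithful where
  map_injective h := le_antisymm ((hF.map_le_map_iff _ _).1 h.le) ((hF.map_le_map_iff _ _).1 h.ge)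

/-- Fullness turns the order embedding of each hom-set into an order isomorphism, which preserves
and reflects meets. -/
theorem isGLB_map_iff [F.Full] (hF : IsDaggerOrderEmbedding F) {X Y : C} (f g m : X ⟶ Y) :
    IsGLB {F.map f, F.map g} (F.map m) ↔ IsGLB {f, g} m := by
  simp only [isGLB_iff_le_iff, mem_lowerBounds, Set.mem_insert_iff, Set.mem_singleton_iff,
    forall_eq_or_imp, forall_eq, F.map_surjective.forall, hF.map_le_map_iff]

theorem isAllegoryMorphism [F.Full] (hF : IsDaggerOrderEmbedding F) : IsAllegoryMorphism F where
  map_meet f g m := (hF.isGLB_map_iff f g m).2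
  map_dagger := hF.map_dagger

/-- The axioms mention only order, composition and dagger, so each can be tested after applying F;
fullness brings the meet back from D. -/
theorem isAllegory [F.Full] (hF : IsDaggerOrderEmbedding F) (hD : IsAllegory D) :
    IsAllegory C where
  exists_meet f g := by
    obtain ⟨m, hm⟩ := hD.exists_meet (F.map f) (F.map g)
    obtain ⟨m, rfl⟩ := F.map_surjective m
    exact ⟨m, (hF.isGLB_map_iff f g m).1 hm⟩
  dagger_mono {X Y f g} h := by
    rw [← hF.map_le_map_iff, hF.map_dagger, hF.map_dagger]
    exact hD.dagger_mono ((hF.map_le_map_iff f g).2 h)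
  modular f g h m n hm hn := by
    rw [← hF.map_le_map_iff, F.map_comp]
    rw [← hF.isGLB_map_iff, F.map_comp] at hm hn
    rw [hF.map_dagger] at hn
    exact hD.modular _ _ _ _ _ hm hn

end IsDaggerOrderEmbedding

theorem isDaggerOrderEmbedding_ι (P : ObjectProperty C) : IsDaggerOrderEmbedding P.ι where
  map_le_map_iff _ _ := Iff.rfl
  map_dagger _ := rfl

theorem IsAllegory.fullSubcategory (hC : IsAllegory C) (P : ObjectProperty C) :
    IsAllegory P.FullSubcategory :=
  (isDaggerOrderEmbedding_ι P).isAllegory hC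

theorem IsDaggerOrderEmbedding.lift {F : C ⥤ D} (hF : IsDaggerOrderEmbedding F)
    (P : ObjectProperty C) (Q : ObjectProperty D) (h : ∀ X : P.FullSubcategory, Q (F.obj X.obj)) :
    IsDaggerOrderEmbedding (Q.lift (P.ι ⋙ F) h) where
  map_le_map_iff f g := hF.map_le_map_iff f.hom g.hom
  map_dagger f := Q.hom_ext (hF.map_dagger f.hom)

theorem IsDaggerOrderEmbedding.isAllegoryEquivalence {F : C ⥤ D}
    (hF : IsDaggerOrderEmbedding F) (hF' : F.IsEquivalence) : IsAllegoryEquivalence F :=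
  ⟨hF.isAllegoryMorphism, hF'⟩

end Transport

/-! ### The allegory of S5-subordination spaces -/

section Spaces

/-- The meet of two morphisms of `StoneE^R` is their intersection. -/
def StoneER.meet {X Y : StoneER.{u}} (f g : X ⟶ Y) : X ⟶ Y where
  rel := f.rel ∩ g.rel
  isClosed := f.isClosed.inter g.isClosed
  rel_comp := by
    ext ⟨x, y⟩
    refine ⟨?_, fun h => ⟨x, X.isEquivRel.refl x, h⟩⟩
    rintro ⟨x', h, h1, h2⟩
    exact ⟨f.rel_comp.subset ⟨x', h, h1⟩, g.rel_comp.subset ⟨x', h, h2⟩⟩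
  comp_rel := by
    ext ⟨x, y⟩
    refine ⟨?_, fun h => ⟨y, h, Y.isEquivRel.refl y⟩⟩
    rintro ⟨y', ⟨h1, h2⟩, h⟩
    exact ⟨f.comp_rel.subset ⟨y', h1, h⟩, g.comp_rel.subset ⟨y', h2, h⟩⟩

theorem StoneER.isGLB_meet {X Y : StoneER.{u}} (f g : X ⟶ Y) :
    IsGLB {f, g} (StoneER.meet f g) := by
  refine ⟨?_, fun h hh => Set.subset_inter (hh (by simp)) (hh (by simp))⟩
  rintro _ (rfl | rfl)
  exacts [Set.inter_subset_left, Set.inter_subset_right]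

theorem StoneER.isAllegory : IsAllegory StoneER.{u} where
  exists_meet f g := ⟨_, StoneER.isGLB_meet f g⟩
  dagger_mono h := fun _ hp => h hp
  modular f g h m n hm hn := by
    rw [hm.unique (StoneER.isGLB_meet _ _), hn.unique (StoneER.isGLB_meet _ _)]
    rintro ⟨x, z⟩ ⟨⟨y, hxy, hyz⟩, hxz⟩
    -- The same midpoint y serves: it reaches z through g, and also by going back to x along the
    -- converse of f and then along h.
    exact ⟨y, hxy, hyz, x, hxy, hxz⟩

end Spaces

/-! ### Separation by ultrafilters -/

section Separation

variable {A B : Type*} [BooleanAlgebra A] [BooleanAlgebra B]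

/-- A filter and an ideal that are disjoint are separated by an ultrafilter. -/
theorem Ult.exists_of_disjoint {F I : Set B} (hF : Order.IsPFilter F) (hI : Order.IsIdeal I)
    (hd : Disjoint F I) : ∃ x : Ult B, F ⊆ x.carrier ∧ Disjoint x.carrier I := by
  obtain ⟨J, hJ, hIJ, hFJ⟩ := DistribLattice.prime_ideal_of_disjoint_filter_ideal
    (F := hF.toPFilter) (I := hI.toIdeal) hd
  refine ⟨⟨(J : Set B)ᶜ, hJ.top_notMem, fun h => h J.bot_mem, ?_, ?_, ?_⟩, ?_, ?_⟩
  · exact fun ha hb hab => (hJ.mem_or_mem hab).elim ha hb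
  · exact fun hab ha hb => ha (J.lower hab hb)
  · intro a
    by_contra! h'
    have h1 : a ∈ J := not_not.1 h'.1
    have h2 : aᶜ ∈ J := not_not.1 h'.2
    exact hJ.top_notMem (by simpa using Order.Ideal.sup_mem h1 h2)
  · exact fun b hb hbJ => Set.disjoint_left.1 hFJ hb hbJ
  · exact Set.disjoint_left.2 fun b hb hbI => hb (hIJ hbI)

theorem isPFilter_Ici (a : B) : Order.IsPFilter (Set.Ici a) :=
  .of_def ⟨a, le_rfl⟩ (fun _ hb _ hc => ⟨a, le_rfl, hb, hc⟩) fun hbc hb => le_trans hb hbc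

theorem isIdeal_Iic (a : B) : Order.IsIdeal (Set.Iic a) :=
  ⟨fun _ _ hbc hb => le_trans hbc hb, ⟨a, le_rfl⟩, fun _ hb _ hc => ⟨a, le_rfl, hb, hc⟩⟩

theorem Ult.exists_mem_notMem {a b : B} (h : ¬a ≤ b) :
    ∃ x : Ult B, a ∈ x.carrier ∧ b ∉ x.carrier := by
  obtain ⟨x, hx, hx'⟩ := Ult.exists_of_disjoint (isPFilter_Ici a) (isIdeal_Iic b)
    (Set.disjoint_left.2 fun c hc hc' => h (le_trans hc hc'))
  exact ⟨x, hx le_rfl, fun hb => Set.disjoint_left.1 hx' hb le_rfl⟩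

theorem Ult.exists_mem {a : B} (h : a ≠ ⊥) : ∃ x : Ult B, a ∈ x.carrier :=
  (Ult.exists_mem_notMem (mt le_bot_iff.1 h)).imp fun _ hx => hx.1

theorem Ult.basic_subset_iff {a b : B} :
    {x : Ult B | a ∈ x.carrier} ⊆ {x | b ∈ x.carrier} ↔ a ≤ b := by
  refine ⟨fun h => ?_, fun h x => x.mem_of_le h⟩
  by_contra hab
  obtain ⟨x, ha, hb⟩ := Ult.exists_mem_notMem hab
  exact hb (h ha)

/-- The ultrafilter relation of a subordination determines the subordination. -/
theorem IsSubordination.rel_iff {S : SetRel A B} (hS : IsSubordination S) {a : A} {b : B} :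
    a ~[S] b ↔ ∀ x y, x ~[ultRel S] y → a ∈ x.carrier → b ∈ y.carrier := by
  refine ⟨fun h x y hxy ha => hxy ⟨a, ha, h⟩, fun h => ?_⟩
  by_contra hab
  -- Choose y first: the filter S[a] misses the ideal below b, so some y contains S[a] and omits b.
  have hF : Order.IsPFilter {c | a ~[S] c} := by
    refine .of_def ⟨⊤, hS.mono le_top hS.top_top le_rfl⟩ ?_ fun hbc hb => hS.mono le_rfl hb hbc
    exact fun c hc d hd => ⟨c ⊓ d, hS.inf_right hc hd, inf_le_left, inf_le_right⟩
  obtain ⟨y, hy, hy'⟩ := Ult.exists_of_disjoint hF (isIdeal_Iic b)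
    (Set.disjoint_left.2 fun c hc hc' => hab (hS.mono le_rfl hc hc'))
  -- An ultrafilter x satisfies S[x] ⊆ y exactly when it avoids this ideal. No element above a lies
  -- in the ideal, because S[a] ⊆ y, so such an x can be chosen to contain a.
  have hI : Order.IsIdeal (S.preimage y.carrierᶜ) := by
    refine ⟨?_, ⟨⊥, ⊥, y.bot_notMem, hS.bot_bot⟩, ?_⟩
    · rintro c c' hc ⟨d, hd, hcd⟩
      exact ⟨d, hd, hS.mono hc hcd le_rfl⟩
    · rintro c ⟨d, hd, hcd⟩ c' ⟨d', hd', hcd'⟩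
      exact ⟨c ⊔ c', ⟨d ⊔ d', fun h => (y.sup_mem_iff.1 h).elim hd hd',
        hS.sup_left (hS.mono le_rfl hcd le_sup_left) (hS.mono le_rfl hcd' le_sup_right)⟩,
        le_sup_left, le_sup_right⟩
  obtain ⟨x, hx, hx'⟩ := Ult.exists_of_disjoint (isPFilter_Ici a) hI
    (Set.disjoint_left.2 fun c hc ⟨d, hd, hcd⟩ => hd (hy (hS.mono hc hcd le_rfl)))
  refine Set.disjoint_left.1 hy' (h x y ?_ (hx le_rfl)) le_rfl
  rintro d ⟨c, hc, hcd⟩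
  by_contra hd
  exact Set.disjoint_left.1 hx' hc ⟨d, hd, hcd⟩

/-- A larger subordination imposes more conditions on a pair of ultrafilters. This reversal is why
hom-sets of algebras carry reverse inclusion. -/
theorem IsSubordination.ultRel_subset_iff {S T : SetRel A B} (hS : IsSubordination S) :
    ultRel S ⊆ ultRel T ↔ T ⊆ S := by
  refine ⟨fun h ⟨a, b⟩ hab => hS.rel_iff.2 fun x y hxy ha => h hxy ⟨a, ha, hab⟩, ?_⟩
  rintro h ⟨x, y⟩ hxy b ⟨a, ha, hab⟩
  exact hxy ⟨a, ha, h hab⟩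

theorem IsSubordination.ultRel_injective {S T : SetRel A B} (hS : IsSubordination S)
    (hT : IsSubordination T) (h : ultRel S = ultRel T) : S = T :=
  subset_antisymm (hT.ultRel_subset_iff.1 h.ge) (hS.ultRel_subset_iff.1 h.le)

/-- Membership of ¬a in an ultrafilter is non-membership of a, so S[x] ⊆ y is the contrapositive of
the corresponding inclusion from y to x. -/
theorem ultRel_complInv (S : SetRel A B) : ultRel (complInv S) = (ultRel S).inv := by
  ext ⟨y, x⟩
  constructor
  · rintro h b ⟨a, ha, hab⟩
    by_contra hb
    exact x.compl_mem_iff.1 (h ⟨bᶜ, y.compl_mem_iff.2 hb, by simpa [complInv] using hab⟩) ha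
  · rintro h a ⟨b, hb, hab⟩
    by_contra ha
    exact y.compl_mem_iff.1 (h ⟨aᶜ, x.compl_mem_iff.2 ha, hab⟩) hb

theorem Ult.isTopologicalBasis :
    TopologicalSpace.IsTopologicalBasis {U : Set (Ult B) | ∃ a : B, U = {x | a ∈ x.carrier}} where
  exists_subset_inter := by
    rintro _ ⟨a, rfl⟩ _ ⟨b, rfl⟩ x ⟨ha, hb⟩
    exact ⟨_, ⟨a ⊓ b, rfl⟩, x.inf_mem ha hb, fun y hy =>
      ⟨y.mem_of_le inf_le_left hy, y.mem_of_le inf_le_right hy⟩⟩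
  sUnion_eq := Set.eq_univ_of_forall fun x => ⟨_, ⟨⊤, rfl⟩, x.top_mem⟩
  eq_generateFrom := rfl

theorem Ult.exists_basic_subset {U : Set (Ult B)} (hU : IsOpen U) {x : Ult B} (hx : x ∈ U) :
    ∃ a ∈ x.carrier, {y : Ult B | a ∈ y.carrier} ⊆ U := by
  obtain ⟨_, ⟨a, rfl⟩, ha, h⟩ := Ult.isTopologicalBasis.exists_subset_of_mem_open hx hU
  exact ⟨a, ha, h⟩

theorem Ult.eq_basic_of_isClopen {U : Set (Ult B)} (hU : IsClopen U) :
    ∃ a : B, U = {x | a ∈ x.carrier} := by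
  suffices ∃ a : B, U ⊆ {x | a ∈ x.carrier} ∧ {x : Ult B | a ∈ x.carrier} ⊆ U from
    this.imp fun a h => subset_antisymm h.1 h.2
  -- Compactness induction on subsets s of U that fit inside some φ(a) ⊆ U: joins in B handle finite
  -- unions, and s = U is the claim.
  refine hU.isClosed.isCompact.induction_on
    (p := fun s => ∃ a : B, s ⊆ {x | a ∈ x.carrier} ∧ {x : Ult B | a ∈ x.carrier} ⊆ U)
    ⟨⊥, Set.empty_subset _, fun x hx => (x.bot_notMem hx).elim⟩ ?_ ?_ ?_
  · rintro s t hst ⟨a, h, h'⟩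
    exact ⟨a, hst.trans h, h'⟩
  · rintro s t ⟨a, ha, ha'⟩ ⟨b, hb, hb'⟩
    refine ⟨a ⊔ b, ?_, fun x hx => (x.sup_mem_iff.1 hx).elim (@ha' x) (@hb' x)⟩
    exact Set.union_subset (fun x hx => x.sup_mem_iff.2 (.inl (ha hx)))
      (fun x hx => x.sup_mem_iff.2 (.inr (hb hx)))
  · intro x hx
    obtain ⟨a, ha, h⟩ := Ult.exists_basic_subset hU.isOpen hx
    exact ⟨_, mem_nhdsWithin_of_mem_nhds ((Ult.isOpen_basic a).mem_nhds ha), a, subset_rfl, h⟩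

/-- Every closed relation between spaces of ultrafilters comes from a subordination. -/
theorem exists_ultRel_eq {R : SetRel (Ult A) (Ult B)} (hR : IsClosed R) :
    ∃ S : SetRel A B, IsSubordination S ∧ ultRel S = R := by
  -- The only possible choice, by `IsSubordination.rel_iff`: a S b when R sends φ(a) into φ(b).
  refine ⟨{p | ∀ x y, x ~[R] y → p.1 ∈ x.carrier → p.2 ∈ y.carrier}, ⟨?_, ?_, ?_, ?_, ?_⟩, ?_⟩
  · exact fun x y _ hx => (x.bot_notMem hx).elim
  · exact fun x y _ _ => y.top_mem
  · exact fun h h' x y hxy hx => (x.sup_mem_iff.1 hx).elim (h x y hxy) (h' x y hxy)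
  · exact fun h h' x y hxy hx => y.inf_mem (h x y hxy hx) (h' x y hxy hx)
  · exact fun h h' h'' x y hxy hx => y.mem_of_le h'' (h' x y hxy (x.mem_of_le h hx))
  · ext ⟨x, y⟩
    refine ⟨fun h => ?_, fun h b ⟨a, ha, hab⟩ => hab x y h ha⟩
    by_contra hxy
    obtain ⟨U, V, hU, hV, hx, hy, hUV⟩ := isOpen_prod_iff.1 hR.isOpen_compl x y hxy
    obtain ⟨a, ha, haU⟩ := Ult.exists_basic_subset hU hx
    obtain ⟨b, hb, hbV⟩ := Ult.exists_basic_subset hV hy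
    -- The box φ(a) × φ(b) around (x, y) misses R, so a S ¬b; this forces ¬b into y, which contains
    -- b.
    refine y.compl_mem_iff.1 (h ⟨a, ha, fun x' y' h' hx' => ?_⟩) hb
    exact y'.compl_mem_iff.2 fun hy' => hUV (Set.mk_mem_prod (haU hx') (hbV hy')) h'

end Separation

/-! ### Full faithfulness of `Ult` and the allegory of algebras -/

section UltFunctor

theorem ult_isDaggerOrderEmbedding : IsDaggerOrderEmbedding ult.{u} where
  map_le_map_iff f _ := f.isSub.ultRel_subset_iff
  map_dagger f := StoneER.Hom.ext (ultRel_complInv f.rel)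

instance : ult.{u}.Faithful := ult_isDaggerOrderEmbedding.faithful

instance : ult.{u}.Full where
  map_surjective {A B} f := by
    obtain ⟨S, hS, h⟩ := exists_ultRel_eq f.isClosed
    -- Compatibility of S with the two S5-subordinations may be checked on ultrafilter relations,
    -- where it is the compatibility of f.
    refine ⟨⟨S, hS, (A.isS5.comp hS).ultRel_injective hS ?_,
      (hS.comp B.isS5.toIsSubordination).ultRel_injective hS ?_⟩, StoneER.Hom.ext h⟩
    · rw [ultRel_comp A.isS5.toIsSubordination hS, h]
      exact f.rel_comp
    · rw [ultRel_comp hS B.isS5.toIsSubordination, h]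
      exact f.comp_rel

theorem SubS5S.isAllegory : IsAllegory SubS5S.{u} :=
  ult_isDaggerOrderEmbedding.isAllegory StoneER.isAllegory

end UltFunctor

/-! ### The points of a Stone space as ultrafilters of clopen sets -/

section Points

open TopologicalSpace (Clopens)

variable {X Y : Type*} [TopologicalSpace X] [TopologicalSpace Y]

/-- The ultrafilter of clopen neighbourhoods of a point. -/
def clopenNhds (x : X) : Ult (Clopens X) where
  carrier := {U | x ∈ U}
  top_mem := trivial
  bot_notMem := id
  inf_mem h h' := ⟨h, h'⟩
  mem_of_le h h' := h h'
  mem_or_compl_mem U := em (x ∈ U)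

/-- Members of an ultrafilter of clopen sets have the finite intersection property, so by
compactness they share a point x. The ultrafilter is then contained in that of x, and comparable
ultrafilters are equal. -/
theorem clopenNhds_surjective [CompactSpace X] :
    Function.Surjective (clopenNhds : X → Ult (Clopens X)) := by
  intro p
  obtain ⟨x, hx⟩ : (⋂ U : p.carrier, (U.1 : Set X)).Nonempty := by
    refine CompactSpace.iInter_nonempty (fun U => U.1.isClosed) fun s => ?_
    have hs : s.inf (fun U : p.carrier => (U : Clopens X)) ∈ p.carrier :=
      Finset.inf_induction p.top_mem (fun _ h _ h' => p.inf_mem h h') fun U _ => U.2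
    obtain ⟨x, hx⟩ :
        ((s.inf fun U : p.carrier => (U : Clopens X) : Clopens X) : Set X).Nonempty := by
      rw [Set.nonempty_iff_ne_empty]
      intro h
      exact p.bot_notMem ((Clopens.ext h : _ = (⊥ : Clopens X)) ▸ hs)
    exact ⟨x, Set.mem_iInter₂.2 fun U hU =>
      Finset.inf_le (f := fun U : p.carrier => (U : Clopens X)) hU hx⟩
  have h : p.carrier ⊆ (clopenNhds x).carrier := fun U hU => Set.mem_iInter.1 hx ⟨U, hU⟩
  refine ⟨x, Ult.ext (subset_antisymm (fun U hU => ?_) h)⟩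
  by_contra hU'
  exact (clopenNhds x).compl_mem_iff.1 (h (p.compl_mem_iff.2 hU')) hU

theorem continuous_clopenNhds : Continuous (clopenNhds : X → Ult (Clopens X)) := by
  refine continuous_generateFrom_iff.2 ?_
  rintro _ ⟨U, rfl⟩
  exact U.isOpen

variable [CompactSpace X] [T2Space X] [TotallyDisconnectedSpace X] [CompactSpace Y] [T2Space Y]
  [TotallyDisconnectedSpace Y]

/-- A pair outside the closed set R lies in a clopen box U' × V' missing R, so U' is related to the
complement of V' and the ultrafilters are not related. -/
theorem ultRel_clopRel_iff {R : SetRel X Y} (hR : IsClosed R) {x : X} {y : Y} :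
    clopenNhds x ~[ultRel (clopRel R)] clopenNhds y ↔ x ~[R] y := by
  constructor
  · intro h
    by_contra hxy
    obtain ⟨U, V, hU, hV, hx, hy, hUV⟩ := isOpen_prod_iff.1 hR.isOpen_compl x y hxy
    obtain ⟨U', hU', hxU, hU'U⟩ := compact_exists_isClopen_in_isOpen hU hx
    obtain ⟨V', hV', hyV, hV'V⟩ := compact_exists_isClopen_in_isOpen hV hy
    refine h (show (⟨V', hV'⟩ : Clopens Y)ᶜ ∈ _ from ⟨⟨U', hU'⟩, hxU, ?_⟩) hyV
    rintro y' ⟨x', hx', hxy'⟩ hy'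
    exact hUV (Set.mk_mem_prod (hU'U hx') (hV'V hy')) hxy'
  · rintro h V ⟨U, hx, hUV⟩
    exact hUV ⟨x, hx, h⟩

theorem clopRel_subset_iff {R Q : SetRel X Y} (hR : IsClosed R) (hQ : IsClosed Q) :
    clopRel Q ⊆ clopRel R ↔ R ⊆ Q := by
  constructor
  · rintro h ⟨x, y⟩ hxy
    refine (ultRel_clopRel_iff hQ).1 ?_
    exact (clopRel_isSubordination R).ultRel_subset_iff.2 h ((ultRel_clopRel_iff hR).2 hxy)
  · rintro h ⟨U, V⟩ hUV y ⟨x, hx, hxy⟩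
    exact hUV ⟨x, hx, h hxy⟩

end Points

/-! ### The natural isomorphisms -/

section Unit

open TopologicalSpace (Clopens)

/-- The component at `(X, E)` of the isomorphism from the identity to `Ult ∘ Clop`: it relates `x`
to the ultrafilters that are related to the ultrafilter of `x`. -/
def unitHom (X : StoneER.{u}) : X ⟶ ult.obj (clop.obj X) where
  rel := {p | clopenNhds p.1 ~[ultRel (clopRel X.rel)] p.2}
  isClosed := (ultRel_isClosed (clopRel X.rel)).preimage
    ((continuous_clopenNhds.comp continuous_fst).prodMk continuous_snd)
  rel_comp := by
    ext ⟨x, p⟩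
    obtain ⟨y, rfl⟩ := clopenNhds_surjective p
    refine ⟨?_, fun h => ⟨x, X.isEquivRel.refl x, h⟩⟩
    rintro ⟨x', h, h'⟩
    exact (ultRel_clopRel_iff X.isClosed).2
      (X.isEquivRel.trans h ((ultRel_clopRel_iff X.isClosed).1 h'))
  comp_rel := by
    ext ⟨x, p⟩
    have h := ultRel_isEquivRel (clop.obj X).isS5
    exact ⟨fun ⟨q, h1, h2⟩ => h.trans h1 h2, fun h1 => ⟨p, h1, h.refl p⟩⟩

theorem unitHom_rel_iff {X : StoneER.{u}} {x y : X.space} :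
    (x, clopenNhds y) ∈ (unitHom X).rel ↔ (x, y) ∈ X.rel :=
  ultRel_clopRel_iff X.isClosed

/-- `unitHom` is an isomorphism whose inverse is its dagger. -/
def unitIso (X : StoneER.{u}) : X ≅ ult.obj (clop.obj X) where
  hom := unitHom X
  inv := DaggerCategory.dagger (unitHom X)
  hom_inv_id := by
    refine StoneER.Hom.ext (Set.ext ?_)
    rintro ⟨x, y⟩
    constructor
    · rintro ⟨p, hx, hy⟩
      -- Replacing the ultrafilter by a point z reduces the composite to x E z and y E z.
      obtain ⟨z, rfl⟩ := clopenNhds_surjective p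
      exact X.isEquivRel.trans (unitHom_rel_iff.1 hx) (X.isEquivRel.symm (unitHom_rel_iff.1 hy))
    · intro h
      exact ⟨clopenNhds y, unitHom_rel_iff.2 h, unitHom_rel_iff.2 (X.isEquivRel.refl y)⟩
  inv_hom_id := by
    refine StoneER.Hom.ext (Set.ext ?_)
    rintro ⟨p, q⟩
    obtain ⟨x, rfl⟩ := clopenNhds_surjective p
    have h := ultRel_isEquivRel (clop.obj X).isS5
    exact ⟨fun ⟨y, hx, hy⟩ => h.trans (h.symm hx) hy, fun hx => ⟨x, h.refl _, hx⟩⟩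

/-- The identity of `StoneE^R` is isomorphic to `Ult ∘ Clop`. -/
def unitNatIso : 𝟭 StoneER.{u} ≅ clop ⋙ ult :=
  NatIso.ofComponents unitIso fun {X Y} f => by
    refine StoneER.Hom.ext (Set.ext ?_)
    rintro ⟨x, q⟩
    obtain ⟨z, rfl⟩ := clopenNhds_surjective q
    -- On points, both composites reduce to x f z, since f absorbs the equivalence relations on
    -- either side.
    constructor
    · rintro ⟨y, hxy, hyz⟩
      exact ⟨clopenNhds x, unitHom_rel_iff.2 (X.isEquivRel.refl x), (ultRel_clopRel_iff
        f.isClosed).2 (f.comp_rel.subset ⟨y, hxy, unitHom_rel_iff.1 hyz⟩)⟩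
    · rintro ⟨p, hxp, hpz⟩
      obtain ⟨y, rfl⟩ := clopenNhds_surjective p
      exact ⟨z, f.rel_comp.subset ⟨y, unitHom_rel_iff.1 hxp,
        (ultRel_clopRel_iff f.isClosed).1 hpz⟩, unitHom_rel_iff.2 (Y.isEquivRel.refl z)⟩

/-- `Clop ∘ Ult` is isomorphic to the identity of `SubS5^S`. -/
noncomputable def counitNatIso : ult ⋙ clop ≅ 𝟭 SubS5S.{u} :=
  -- The component at B is the preimage under `Ult` of the inverse unit at Ult(B). Naturality is
  -- tested after applying the faithful `Ult`, where it is naturality of the inverse unit.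
  NatIso.ofComponents (fun B => ult.preimageIso (unitIso (ult.obj B)).symm) fun {A B} f => by
    apply ult.map_injective
    have h := unitNatIso.inv.naturality (ult.map f)
    simpa [unitNatIso] using h

theorem clop_isDaggerOrderEmbedding : IsDaggerOrderEmbedding clop.{u} where
  map_le_map_iff f g := clopRel_subset_iff f.isClosed g.isClosed
  map_dagger {X Y} f := by
    -- The converse of f sends V into U iff f sends the complement of U into the complement of V.
    refine SubS5S.Hom.ext (Set.ext ?_)
    rintro ⟨V, U⟩
    constructor
    · rintro h y ⟨x, hx, hxy⟩ hy
      exact hx (h ⟨y, hy, hxy⟩)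
    · rintro h x ⟨y, hy, hxy⟩
      by_contra hx
      exact h ⟨x, hx, hxy⟩ hy

theorem clop_isAllegoryEquivalence : IsAllegoryEquivalence clop.{u} :=
  have : clop.{u}.IsEquivalence :=
    (CategoryTheory.Equivalence.mk clop ult unitNatIso counitNatIso).isEquivalence_functor
  clop_isDaggerOrderEmbedding.isAllegoryEquivalence this

theorem ult_isAllegoryEquivalence : IsAllegoryEquivalence ult.{u} :=
  have : ult.{u}.IsEquivalence :=
    (CategoryTheory.Equivalence.mk clop ult unitNatIso counitNatIso).isEquivalence_inverse
  ult_isDaggerOrderEmbedding.isAllegoryEquivalence this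

end Unit

/-! ### Completeness and extremal disconnectedness -/

section Complete

open TopologicalSpace (Clopens)

theorem isCompleteAlg_iff_extremallyDisconnected (B : Type*) [BooleanAlgebra B] :
    IsCompleteAlg B ↔ ExtremallyDisconnected (Ult B) := by
  constructor
  · refine fun hB => ⟨fun U hU => ?_⟩
    -- The supremum of all a with φ(a) ⊆ U; φ(c) will be the closure of U.
    obtain ⟨c, hc⟩ := hB {a | {x : Ult B | a ∈ x.carrier} ⊆ U}
    suffices closure U = {x : Ult B | c ∈ x.carrier} from this ▸ Ult.isOpen_basic c
    refine subset_antisymm (closure_minimal (fun x hx => ?_) (Ult.isClopen_basic c).isClosed) ?_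
    · obtain ⟨a, ha, haU⟩ := Ult.exists_basic_subset hU hx
      exact x.mem_of_le (hc.1 haU) ha
    · intro x hx
      by_contra hxU
      obtain ⟨b, hb, hbU⟩ := Ult.exists_basic_subset isClosed_closure.isOpen_compl hxU
      -- A basic neighbourhood φ(b) of x disjoint from U makes ¬b an upper bound of the family, so c
      -- ≤ ¬b, contradicting b, c ∈ x.
      refine x.compl_mem_iff.1 (x.mem_of_le (hc.2 fun a ha => ?_) hx) hb
      refine Ult.basic_subset_iff.1 fun y hy => y.compl_mem_iff.2 fun hyb => ?_
      exact hbU hyb (subset_closure (ha hy))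
  · intro h s
    have hU : IsOpen (⋃ a ∈ s, {x : Ult B | a ∈ x.carrier}) :=
      isOpen_biUnion fun a _ => Ult.isOpen_basic a
    -- The closure of the union is clopen, hence some φ(c). As the least closed set containing every
    -- φ(a), it gives the supremum.
    obtain ⟨c, hc⟩ := Ult.eq_basic_of_isClopen ⟨isClosed_closure, h.open_closure _ hU⟩
    refine ⟨c, fun a ha => ?_, fun b hb => ?_⟩ <;> rw [← Ult.basic_subset_iff, ← hc]
    · exact (Set.subset_biUnion_of_mem (u := fun a => {x : Ult B | a ∈ x.carrier}) ha).trans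
        subset_closure
    · exact closure_minimal (Set.iUnion₂_subset fun a ha => Ult.basic_subset_iff.2 (hb ha))
        (Ult.isClopen_basic b).isClosed

/-- The supremum is the closure of the union. Arguing on X itself avoids transporting extremal
disconnectedness to the space of ultrafilters. -/
theorem isCompleteAlg_clopens (X : Type*) [TopologicalSpace X] [ExtremallyDisconnected X] :
    IsCompleteAlg (Clopens X) := by
  intro s
  have hU : IsOpen (⋃ U ∈ s, (U : Set X)) := isOpen_biUnion fun U _ => U.isOpen
  refine ⟨⟨closure (⋃ U ∈ s, (U : Set X)), isClosed_closure,
    ExtremallyDisconnected.open_closure _ hU⟩, fun U hU => ?_, fun V hV => ?_⟩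
  · exact (Set.subset_biUnion_of_mem (u := fun U : Clopens X => (U : Set X)) hU).trans
      subset_closure
  · exact closure_minimal (Set.iUnion₂_subset fun U hU => hV hU) V.isClosed

end Complete

/-! ### Irreducibility and S8 -/

section Irreducible

open TopologicalSpace (Clopens)

/-- With E = R_S symmetric, b S a iff φ(b) is disjoint from E[φ(¬a)]. Since E-images of closed sets
are closed, (S8) says that E[φ(¬a)] is proper for each a ≠ 0, and every proper closed set lies in
such a φ(¬a). -/
theorem isIrreducibleRel_ultRel_iff {B : Type*} [BooleanAlgebra B] {S : SetRel B B}
    (hS : IsS5Subordination S) : IsIrreducibleRel (ultRel S) ↔ SatisfiesS8 S := by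
  have hE := ultRel_isEquivRel hS
  constructor
  · intro h a ha
    obtain ⟨x, hx⟩ := Ult.exists_mem ha
    obtain ⟨hc, hn⟩ := h {y | aᶜ ∈ y.carrier} (Ult.isClopen_basic aᶜ).isClosed fun h' =>
      x.compl_mem_iff.1 (h' ▸ Set.mem_univ x : x ∈ {y : Ult B | aᶜ ∈ y.carrier}) hx
    obtain ⟨y, hy⟩ := (Set.ne_univ_iff_exists_notMem _).1 hn
    obtain ⟨b, hb, hbF⟩ := Ult.exists_basic_subset hc.isOpen_compl hy
    refine ⟨b, fun h' => y.bot_notMem (h' ▸ hb), hS.toIsSubordination.rel_iff.2 ?_⟩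
    intro z t hzt hz
    by_contra ht
    exact hbF hz ⟨t, t.compl_mem_iff.2 ht, hE.symm hzt⟩
  · intro h F hF hF'
    obtain ⟨x, hx⟩ := (Set.ne_univ_iff_exists_notMem _).1 hF'
    obtain ⟨a, ha, haF⟩ := Ult.exists_basic_subset hF.isOpen_compl hx
    obtain ⟨b, hb, hba⟩ := h a fun h' => x.bot_notMem (h' ▸ ha)
    -- Any y containing b lies outside E[F]: a point z of F related to y would contain a, as b S a,
    -- but φ(a) misses F.
    obtain ⟨y, hy⟩ := Ult.exists_mem hb
    refine ⟨isClosed_image (ultRel_isClosed S) hF, fun h' => ?_⟩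
    obtain ⟨z, hz, hzy⟩ := (h' ▸ Set.mem_univ y : y ∈ (ultRel S).image F)
    exact haF (hE.symm hzy ⟨b, hy, hba⟩) hz

/-- A nonempty clopen U has proper closed complement, so the E-image of that complement omits a
clopen neighbourhood V of some point. By symmetry of E, the image of V stays in U. -/
theorem IsIrreducibleRel.satisfiesS8 {X : Type*} [TopologicalSpace X] [CompactSpace X]
    [T2Space X] [TotallyDisconnectedSpace X] {E : SetRel X X} (hE : IsEquivRel E)
    (h : IsIrreducibleRel E) : SatisfiesS8 (clopRel E) := by
  intro U hU
  obtain ⟨hc, hn⟩ := h (U : Set X)ᶜ U.isOpen.isClosed_compl fun h' =>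
    hU (Clopens.ext (Set.compl_univ_iff.1 h'))
  obtain ⟨x, hx⟩ := (Set.ne_univ_iff_exists_notMem _).1 hn
  obtain ⟨V, hV, hxV, hVF⟩ := compact_exists_isClopen_in_isOpen hc.isOpen_compl hx
  refine ⟨⟨V, hV⟩, fun h' => ?_, ?_⟩
  · exact (congrArg (x ∈ ·) (congrArg ((↑) : Clopens X → Set X) h')).mp hxV
  · rintro y ⟨z, hz, hzy⟩
    by_contra hy
    exact hVF hz ⟨y, hy, hE.symm hzy⟩

end Irreducible

/-! ### The restricted equivalence -/

section Restricted

theorem gleason.deVries_clop {X : StoneER.{u}} (h : gleason X) : deVries (clop.obj X) :=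
  have := h.1
  ⟨isCompleteAlg_clopens X.space, h.2.satisfiesS8 X.isEquivRel⟩

theorem deVries.gleason_ult {B : SubS5S.{u}} (h : deVries B) : gleason (ult.obj B) :=
  ⟨(isCompleteAlg_iff_extremallyDisconnected B.alg).1 h.1,
    (isIrreducibleRel_ultRel_iff B.isS5).2 h.2⟩

/-- The functor `Clop : Gle^R ⥤ DeV^S`. -/
abbrev clopGleason : GleR.{u} ⥤ DeVS.{u} :=
  clopRestrict fun _ => gleason.deVries_clop

/-- The functor `Ult : DeV^S ⥤ Gle^R`. -/
abbrev ultDeVries : DeVS.{u} ⥤ GleR.{u} :=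
  ultRestrict fun _ => deVries.gleason_ult

/-- The restriction of `unitNatIso` to Gleason spaces. -/
def gleasonUnitNatIso : 𝟭 GleR.{u} ≅ clopGleason ⋙ ultDeVries :=
  NatIso.ofComponents (fun X => gleason.isoMk (unitNatIso.app X.obj)) fun f =>
    gleason.hom_ext (unitNatIso.hom.naturality f.hom)

/-- The restriction of `counitNatIso` to de Vries algebras. -/
noncomputable def deVriesCounitNatIso : ultDeVries ⋙ clopGleason ≅ 𝟭 DeVS.{u} :=
  NatIso.ofComponents (fun B => deVries.isoMk (counitNatIso.app B.obj)) fun f =>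
    deVries.hom_ext (counitNatIso.hom.naturality f.hom)

theorem clopGleason_isAllegoryEquivalence : IsAllegoryEquivalence clopGleason.{u} :=
  have : clopGleason.{u}.IsEquivalence :=
    (CategoryTheory.Equivalence.mk _ _ gleasonUnitNatIso deVriesCounitNatIso).isEquivalence_functor
  (clop_isDaggerOrderEmbedding.lift _ _ _).isAllegoryEquivalence this

theorem ultDeVries_isAllegoryEquivalence : IsAllegoryEquivalence ultDeVries.{u} :=
  have : ultDeVries.{u}.IsEquivalence :=
    (CategoryTheory.Equivalence.mk _ _ gleasonUnitNatIso deVriesCounitNatIso).isEquivalence_inverse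
  (ult_isDaggerOrderEmbedding.lift _ _ _).isAllegoryEquivalence this

end Restricted

end ClosedRel

theorem mainTheorem9 :
    -- the ambient equivalence of allegories, given by `Clop` and `Ult`
    ClosedRel.IsAllegory ClosedRel.StoneER.{u} ∧ ClosedRel.IsAllegory ClosedRel.SubS5S.{u} ∧
    ClosedRel.IsAllegoryEquivalence ClosedRel.clop.{u} ∧
    ClosedRel.IsAllegoryEquivalence ClosedRel.ult.{u} ∧
    -- the correspondence between the two pairs of conditions
    (∀ B : BoolAlg.{u},
      ClosedRel.IsCompleteAlg B ↔ ExtremallyDisconnected (ClosedRel.Ult B)) ∧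
    (∀ B : ClosedRel.SubS5S.{u},
      ClosedRel.IsIrreducibleRel (ClosedRel.ultRel B.sub) ↔ ClosedRel.SatisfiesS8 B.sub) ∧
    -- the restricted equivalence of allegories
    ClosedRel.IsAllegory ClosedRel.GleR.{u} ∧ ClosedRel.IsAllegory ClosedRel.DeVS.{u} ∧
    ∃ (hClop : ∀ X : ClosedRel.StoneER.{u},
        ClosedRel.gleason X → ClosedRel.deVries (ClosedRel.clop.obj X))
      (hUlt : ∀ B : ClosedRel.SubS5S.{u},
        ClosedRel.deVries B → ClosedRel.gleason (ClosedRel.ult.obj B)),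
      ClosedRel.IsAllegoryEquivalence (ClosedRel.clopRestrict hClop) ∧
      ClosedRel.IsAllegoryEquivalence (ClosedRel.ultRestrict hUlt) ∧
      -- natural isomorphisms making `Clop` and `Ult` quasi-inverse, which restrict
      ∃ (η : 𝟭 ClosedRel.StoneER.{u} ≅ ClosedRel.clop ⋙ ClosedRel.ult)
        (ε : ClosedRel.ult ⋙ ClosedRel.clop ≅ 𝟭 ClosedRel.SubS5S.{u})
        (η' : 𝟭 ClosedRel.GleR.{u} ≅
          ClosedRel.clopRestrict hClop ⋙ ClosedRel.ultRestrict hUlt)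
        (ε' : ClosedRel.ultRestrict hUlt ⋙ ClosedRel.clopRestrict hClop ≅
          𝟭 ClosedRel.DeVS.{u}),
        (∀ X : ClosedRel.GleR.{u}, (η'.hom.app X).hom = η.hom.app X.obj) ∧
        (∀ B : ClosedRel.DeVS.{u}, (ε'.hom.app B).hom = ε.hom.app B.obj) :=
  ⟨ClosedRel.StoneER.isAllegory, ClosedRel.SubS5S.isAllegory,
    ClosedRel.clop_isAllegoryEquivalence, ClosedRel.ult_isAllegoryEquivalence,
    fun B => ClosedRel.isCompleteAlg_iff_extremallyDisconnected B,
    fun B => ClosedRel.isIrreducibleRel_ultRel_iff B.isS5,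
    ClosedRel.StoneER.isAllegory.fullSubcategory _, ClosedRel.SubS5S.isAllegory.fullSubcategory _,
    fun _ => ClosedRel.gleason.deVries_clop, fun _ => ClosedRel.deVries.gleason_ult,
    ClosedRel.clopGleason_isAllegoryEquivalence, ClosedRel.ultDeVries_isAllegoryEquivalence,
    ClosedRel.unitNatIso, ClosedRel.counitNatIso, ClosedRel.gleasonUnitNatIso,
    ClosedRel.deVriesCounitNatIso, fun _ => rfl, fun _ => rfl⟩
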